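/- Let $p_0,p_1,p_2\ge 0$ with $p_0+p_1+p_2=1$, let $\vartheta\in\mathbb R$, and put $$\alpha=\tfrac16\Big(1-3\sum_i p_i^2\Big),\quad \beta=-\sum_{i<j}p_ip_j,\quad \gamma=\tfrac1{27}\Big(-2+9\sum_i p_i^2-9\sum_i p_i^3\Big),$$ $$\delta=\tfrac1{27}\Big(18\sum_{i<j}p_ip_j-27\sum_{i\ne j}p_i^2p_j\Big),\quad \varepsilon=-2p_0p_1p_2\cos\vartheta .$$ For $z\in(0,1)$ let $p(z)=\alpha+\beta z^2$ and $q(z)=\gamma+\delta z^2+\varepsilon z^3$. For real $p<0$ and $q$ such that $|g|\le1$ below, and $k=0,1,2$, let $$t_k(p,q)=2\sqrt{-\tfrac p3}\,\cos\Big(\tfrac13\arccos g-\tfrac{2k\pi}3\Big),\qquad g=\tfrac32\,\tfrac qp\sqrt{-\tfrac3p},$$ and write $t_k(z)=t_k(p(z),q(z))$. Then the following hold. (1) Let $z\in(0,1)$ and let $\psi_0,\psi_1,\psi_2\in\mathbb C^3$ be unit vectors with $\langle\psi_0|\psi_1\rangle=ze^{i\tau_{01}}$, $\langle\psi_1|\psi_2\rangle=ze^{i\tau_{12}}$,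 $\langle\psi_2|\psi_0\rangle=ze^{i\tau_{20}}$, where $\tau_{01},\tau_{12},\tau_{20}$ are real and $\tau_{01}+\tau_{12}+\tau_{20}=\vartheta$. Then the eigenvalues of $\varpi=\sum_k p_k|\psi_k\rangle\langle\psi_k|$, with multiplicity, are $t_k(z)+\tfrac13$, $k=0,1,2$. (2) For every $z\in(0,1)$ one has $p(z)<0$ and $|g|\le1$, and the roots of the reduced cubic $t^3+p(z)t+q(z)$, with multiplicity, are $t_0(z)\ge t_1(z)\ge t_2(z)$. (3) $t_2(p,q)=-t_0(p,-q)$ for all such $p,q$. (4) The function $t_0$ is convex on $(0,1)$. (5) The function $t_2$ is concave on $(0,1)$. In particular (4) and (5) hold when $\varepsilon\le0$, e.g. for $0\le\vartheta\le\pi/2$. -/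

import Mathlib

noncomputable section

namespace TernaryState

/-- `α = (1 - 3 p₀² - 3 p₁² - 3 p₂²) / 6`. -/
def coeffAlpha (w : Fin 3 → ℝ) : ℝ :=
  (1 - 3 * w 0 ^ 2 - 3 * w 1 ^ 2 - 3 * w 2 ^ 2) / 6

/-- `β = -(p₀p₁ + p₀p₂ + p₁p₂)`. -/
def coeffBeta (w : Fin 3 → ℝ) : ℝ :=
  -(w 0 * w 1 + w 0 * w 2 + w 1 * w 2)

/-- `γ = (-2 + 9 ∑ pᵢ² - 9 ∑ pᵢ³) / 27`. -/
def coeffGamma (w : Fin 3 → ℝ) : ℝ :=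
  (-2 + 9 * w 0 ^ 2 - 9 * w 0 ^ 3 + 9 * w 1 ^ 2 - 9 * w 1 ^ 3 + 9 * w 2 ^ 2 - 9 * w 2 ^ 3) / 27

/-- `δ = (18 ∑_{i<j} pᵢpⱼ - 27 ∑_{i≠j} pᵢ²pⱼ) / 27`. -/
def coeffDelta (w : Fin 3 → ℝ) : ℝ :=
  (18 * (w 0 * w 1 + w 0 * w 2 + w 1 * w 2)
    - 27 * (w 0 ^ 2 * w 1 + w 0 * w 1 ^ 2 + w 0 ^ 2 * w 2 + w 1 ^ 2 * w 2
      + w 0 * w 2 ^ 2 + w 1 * w 2 ^ 2)) / 27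

/-- `ε = -2 p₀p₁p₂ cos ϑ`. -/
def coeffEpsilon (w : Fin 3 → ℝ) (ϑ : ℝ) : ℝ :=
  -2 * w 0 * w 1 * w 2 * Real.cos ϑ

/-- The linear coefficient `p(z) = α + β z²` of the reduced cubic `t³ + p t + q`. -/
def cubicP (w : Fin 3 → ℝ) (z : ℝ) : ℝ :=
  coeffAlpha w + coeffBeta w * z ^ 2

/-- The constant coefficient `q(z) = γ + δ z² + ε z³` of the reduced cubic `t³ + p t + q`. -/
def cubicQ (w : Fin 3 → ℝ) (ϑ z : ℝ) : ℝ :=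
  coeffGamma w + coeffDelta w * z ^ 2 + coeffEpsilon w ϑ * z ^ 3

/-- `g = (3/2) (q/p) √(-3/p)`. -/
def core (p q : ℝ) : ℝ :=
  3 / 2 * (q / p) * Real.sqrt (-3 / p)

/-- `t_k(p, q) = 2 √(-p/3) cos (arccos(g)/3 - 2kπ/3)`, `k = 0, 1, 2`. -/
def trigRoot (k : Fin 3) (p q : ℝ) : ℝ :=
  2 * Real.sqrt (-p / 3) *
    Real.cos (Real.arccos (core p q) / 3 - 2 * ((k : ℕ) : ℝ) * Real.pi / 3)

/-- `t_k` as a function of the overlap modulus `z`, for weights `w` and total phase `ϑ`. -/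
def t (w : Fin 3 → ℝ) (ϑ : ℝ) (k : Fin 3) (z : ℝ) : ℝ :=
  trigRoot k (cubicP w z) (cubicQ w ϑ z)

/-- The operator `ϖ = ∑ₖ pₖ |ψₖ⟩⟨ψₖ|` as a `3 × 3` matrix. -/
def mixture (w : Fin 3 → ℝ) (ψ : Fin 3 → EuclideanSpace ℂ (Fin 3)) :
    Matrix (Fin 3) (Fin 3) ℂ :=
  ∑ k, (w k : ℂ) • Matrix.vecMulVec (fun i => ψ k i) (fun j => star (ψ k j))

/-- Three unit vectors whose pairwise overlaps are `⟨ψᵢ|ψⱼ⟩ = z exp(i τᵢⱼ)`, all of the same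
modulus `z`, with total phase `τ₀₁ + τ₁₂ + τ₂₀ = ϑ`. -/
def HasOverlaps (ψ : Fin 3 → EuclideanSpace ℂ (Fin 3)) (z ϑ : ℝ) : Prop :=
  (∀ i, ‖ψ i‖ = 1) ∧
  ∃ τ₀₁ τ₁₂ τ₂₀ : ℝ,
    inner ℂ (ψ 0) (ψ 1) = (z : ℂ) * Complex.exp (τ₀₁ * Complex.I) ∧
    inner ℂ (ψ 1) (ψ 2) = (z : ℂ) * Complex.exp (τ₁₂ * Complex.I) ∧
    inner ℂ (ψ 2) (ψ 0) = (z : ℂ) * Complex.exp (τ₂₀ * Complex.I) ∧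
    τ₀₁ + τ₁₂ + τ₂₀ = ϑ

end TernaryState

end

section

open Polynomial
open scoped Matrix ComplexOrder

namespace TernaryState

/-! With the `ψ k` as columns of `Ψ` and `D = diag(w)`, `ϖ = Ψ D Ψᴴ` has the characteristic
polynomial of `D G`, where `G = Ψᴴ Ψ` is the Gram matrix. A 3 × 3 determinant sees the off-diagonal
entries of `G` only through the 2-cycles `z²` and the 3-cycles, which sum to `2 z³ cos ϑ`; shifting
by `1/3` yields the reduced cubic. Hence `G` may be replaced by `modelGram`, which carries the whole
phase in one pair of entries and is affine in `z`. The matrix `√D G √D` (`modelState`) is Hermitian,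
so the cubic has real roots; the discriminant inequality gives `|g| ≤ 1` and Viète's formula
applies. The largest eigenvalue of an affine Hermitian family is convex and the smallest concave,
which gives the claims on `t₀` and `t₂` with no condition on the sign of `ε`. -/

/-- In terms of the elementary symmetric functions of the weights, `p(z) = -1/3 + e₂ (1 - z²)`. -/
lemma cubicP_eq {w : Fin 3 → ℝ} (hsum : ∑ i, w i = 1) (z : ℝ) :
    cubicP w z = -1 / 3 + (w 0 * w 1 + w 0 * w 2 + w 1 * w 2) * (1 - z ^ 2) := by
  rw [Fin.sum_univ_three] at hsum
  have h : w 2 = 1 - w 0 - w 1 := by linarith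
  simp only [cubicP, coeffAlpha, coeffBeta, h]
  ring

/-- In terms of the elementary symmetric functions of the weights,
`q(z) = -2/27 + e₂ (1 - z²) / 3 - e₃ (1 - 3 z² + 2 z³ cos ϑ)`. -/
lemma cubicQ_eq {w : Fin 3 → ℝ} (hsum : ∑ i, w i = 1) (ϑ z : ℝ) :
    cubicQ w ϑ z = -2 / 27 + (w 0 * w 1 + w 0 * w 2 + w 1 * w 2) * (1 - z ^ 2) / 3
      - w 0 * w 1 * w 2 * (1 - 3 * z ^ 2 + 2 * z ^ 3 * Real.cos ϑ) := by
  rw [Fin.sum_univ_three] at hsum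
  have h : w 2 = 1 - w 0 - w 1 := by linarith
  simp only [cubicQ, coeffGamma, coeffDelta, coeffEpsilon, h]
  ring

/-- Since `e₂ ≤ 1/3`, only `z = 0` with equal weights could give zero among small `z`; `0 < z` makes
the bound strict. -/
lemma cubicP_neg {w : Fin 3 → ℝ} (hw : ∀ i, 0 ≤ w i) (hsum : ∑ i, w i = 1) {z : ℝ} (hz : 0 < z) :
    cubicP w z < 0 := by
  rw [cubicP_eq hsum]
  rw [Fin.sum_univ_three] at hsum
  have h01 := mul_nonneg (hw 0) (hw 1)
  have h02 := mul_nonneg (hw 0) (hw 2)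
  have h12 := mul_nonneg (hw 1) (hw 2)
  have h3 : w 0 * w 1 + w 0 * w 2 + w 1 * w 2 ≤ 1 / 3 := by
    have h : w 2 = 1 - w 0 - w 1 := by linarith
    rw [h]
    nlinarith [sq_nonneg (w 0 - w 1), sq_nonneg (w 0 + w 1 - 2 / 3)]
  have hz2 : 0 < z ^ 2 := by positivity
  rcases (show 0 ≤ w 0 * w 1 + w 0 * w 2 + w 1 * w 2 by positivity).eq_or_lt with h | h
  · rw [← h]; norm_num
  · nlinarith [mul_pos h hz2]

/-! ### Trigonometric roots of the reduced cubic -/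

/-- Comes from `arccos (-g) = π - arccos g`, which holds for the truncated `arccos` too, so no bound
on `g` is needed. -/
lemma trigRoot_two (p q : ℝ) : trigRoot 2 p q = -trigRoot 0 p (-q) := by
  have hcore : core p (-q) = -core p q := by simp only [core]; ring
  simp only [trigRoot, hcore, Real.arccos_neg]
  have : Real.cos (Real.arccos (core p q) / 3 - 2 * (((2 : Fin 3) : ℕ) : ℝ) * Real.pi / 3)
      = -Real.cos ((Real.pi - Real.arccos (core p q)) / 3
        - 2 * (((0 : Fin 3) : ℕ) : ℝ) * Real.pi / 3) := by
    rw [← Real.cos_neg, ← Real.cos_add_pi]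
    congr 1
    simp
    ring
  rw [this]
  ring

lemma trigRoot_one_le_trigRoot_zero (p q : ℝ) : trigRoot 1 p q ≤ trigRoot 0 p q := by
  have h0 := Real.arccos_nonneg (core p q)
  have h1 := Real.arccos_le_pi (core p q)
  refine mul_le_mul_of_nonneg_left ?_ (by positivity)
  rw [← Real.cos_neg]
  -- With `θ = arccos g / 3 ∈ [0, π/3]`, this compares `θ ≤ 2π/3 - θ` inside `[0, π]`.
  apply Real.cos_le_cos_of_nonneg_of_le_pi <;> simp <;> linarith

lemma trigRoot_two_le_trigRoot_one (p q : ℝ) : trigRoot 2 p q ≤ trigRoot 1 p q := by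
  have h0 := Real.arccos_nonneg (core p q)
  have h1 := Real.arccos_le_pi (core p q)
  refine mul_le_mul_of_nonneg_left ?_ (by positivity)
  rw [← Real.cos_add_two_pi, ← Real.cos_neg (_ - 2 * (((1 : Fin 3) : ℕ) : ℝ) * Real.pi / 3)]
  -- Here the angles are `2π/3 - θ ≤ 2π/3 + θ ≤ π`.
  apply Real.cos_le_cos_of_nonneg_of_le_pi <;> simp <;> linarith

/-- A reduced cubic with real roots satisfies `4 p³ + 27 q² ≤ 0`. -/
lemma four_mul_cube_add_nonpos_of_eq_prod {p q : ℝ} {a : Fin 3 → ℝ}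
    (h : (X ^ 3 + C p * X + C q : ℝ[X]) = ∏ k, (X - C (a k))) :
    4 * p ^ 3 + 27 * q ^ 2 ≤ 0 := by
  have ev (x : ℝ) : x ^ 3 + p * x + q = (x - a 0) * (x - a 1) * (x - a 2) := by
    simpa [Fin.prod_univ_three] using congrArg (eval x) h
  -- The values at `0` and `±1` recover Vieta's relations, including the vanishing sum of the roots.
  have e0 := ev 0
  have e1 := ev 1
  have e2 := ev (-1)
  have hs : a 2 = -a 0 - a 1 := by linarith
  have hq : q = -(a 0 * a 1 * a 2) := by linarith
  have hp : p = a 0 * a 1 + a 0 * a 2 + a 1 * a 2 := by linarith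
  have : 4 * p ^ 3 + 27 * q ^ 2 = -((a 0 - a 1) * (a 0 - a 2) * (a 1 - a 2)) ^ 2 := by
    rw [hq, hp, hs]; ring
  rw [this]
  nlinarith [sq_nonneg ((a 0 - a 1) * (a 0 - a 2) * (a 1 - a 2))]

lemma abs_core_le_one {p q : ℝ} (hp : p < 0) (h : 4 * p ^ 3 + 27 * q ^ 2 ≤ 0) :
    |core p q| ≤ 1 := by
  rw [← sq_le_one_iff_abs_le_one]
  have hp3 : 0 < -(4 * p ^ 3) := by
    have := pow_pos (neg_pos.2 hp) 3
    nlinarith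
  have : core p q ^ 2 = 27 * q ^ 2 / -(4 * p ^ 3) := by
    rw [core, mul_pow, Real.sq_sqrt (div_nonneg_of_nonpos (by norm_num) hp.le)]
    field_simp [hp.ne]
    ring
  rw [this, div_le_one hp3]
  linarith

/-- Viète's trigonometric solution of the reduced cubic. -/
lemma cubic_eq_prod_trigRoot {p q : ℝ} (hp : p < 0) (hg : |core p q| ≤ 1) :
    (X ^ 3 + C p * X + C q : ℝ[X]) = ∏ k, (X - C (trigRoot k p q)) := by
  obtain ⟨hg1, hg2⟩ := abs_le.1 hg
  set r := Real.sqrt (-p / 3) with hr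
  set θ := Real.arccos (core p q) / 3 with hθ
  have hr0 : 0 < r := Real.sqrt_pos.2 (by linarith)
  have hr2 : r ^ 2 = -p / 3 := Real.sq_sqrt (by linarith)
  have hcore : core p q = 3 / 2 * (q / p) * r⁻¹ := by
    rw [core, hr, ← Real.sqrt_inv]
    congr 2
    field_simp [hp.ne]
  have h3 : 4 * Real.cos θ ^ 3 - 3 * Real.cos θ = 3 / 2 * (q / p) * r⁻¹ := by
    rw [← Real.cos_three_mul, hθ, mul_div_cancel₀ _ (by norm_num : (3 : ℝ) ≠ 0),
      Real.cos_arccos hg1 hg2, hcore]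
  have hpr : p = -3 * r ^ 2 := by linarith
  have hq : q = -2 * r ^ 3 * (4 * Real.cos θ ^ 3 - 3 * Real.cos θ) := by
    rw [h3, hpr]
    field_simp
  have c3 : Real.cos (2 * Real.pi / 3) = -(1 / 2) := by
    rw [show 2 * Real.pi / 3 = Real.pi - Real.pi / 3 by ring, Real.cos_pi_sub, Real.cos_pi_div_three]
  have s3 : Real.sin (2 * Real.pi / 3) = √3 / 2 := by
    rw [show 2 * Real.pi / 3 = Real.pi - Real.pi / 3 by ring, Real.sin_pi_sub, Real.sin_pi_div_three]
  have t0 : trigRoot 0 p q = 2 * r * Real.cos θ := by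
    simp [trigRoot, ← hr, ← hθ]
  have t1 : trigRoot 1 p q = r * (-Real.cos θ + √3 * Real.sin θ) := by
    have : trigRoot 1 p q = 2 * r * Real.cos (θ - 2 * Real.pi / 3) := by
      simp [trigRoot, ← hr, ← hθ]
    rw [this, Real.cos_sub, c3, s3]
    ring
  have t2 : trigRoot 2 p q = r * (-Real.cos θ - √3 * Real.sin θ) := by
    have : trigRoot 2 p q = 2 * r * Real.cos (θ + 2 * Real.pi / 3) := by
      simp only [trigRoot, ← hr, ← hθ]
      rw [← Real.cos_add_two_pi]
      congr 2
      simp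
      ring
    rw [this, Real.cos_add, c3, s3]
    ring
  refine Polynomial.funext fun x => ?_
  simp only [Fin.prod_univ_three, eval_add, eval_mul, eval_sub, eval_pow, eval_X, eval_C,
    t0, t1, t2]
  have hss : (√3 * Real.sin θ) ^ 2 = 3 * (1 - Real.cos θ ^ 2) := by
    rw [mul_pow, Real.sq_sqrt (by norm_num), Real.sin_sq]
  rw [hq, hpr]
  linear_combination (x - 2 * r * Real.cos θ) * r ^ 2 * hss

/-! ### Characteristic polynomials and the affine Hermitian model -/

/-- The characteristic polynomial of `diag(w) G` for a matrix `G` with unit diagonal whose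
off-diagonal entries have modulus `z` and total phase `ϑ`. -/
lemma charpoly_diagonal_mul_eq_comp {w : Fin 3 → ℝ} (hsum : ∑ i, w i = 1) {ϑ z : ℝ}
    {G : Matrix (Fin 3) (Fin 3) ℂ} (hd : ∀ i, G i i = 1)
    (h01 : G 0 1 * G 1 0 = (z : ℂ) ^ 2) (h12 : G 1 2 * G 2 1 = (z : ℂ) ^ 2)
    (h20 : G 2 0 * G 0 2 = (z : ℂ) ^ 2)
    (h3 : G 0 1 * G 1 2 * G 2 0 + G 0 2 * G 2 1 * G 1 0 = 2 * (z : ℂ) ^ 3 * Complex.cos ϑ) :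
    (Matrix.diagonal (fun i => (w i : ℂ)) * G).charpoly =
      ((X ^ 3 + C (cubicP w z) * X + C (cubicQ w ϑ z)).comp (X - C (1 / 3))).map
        (algebraMap ℝ ℂ) := by
  have hs : (w 0 : ℂ) + w 1 + w 2 = 1 := by
    rw [Fin.sum_univ_three] at hsum
    exact_mod_cast hsum
  have hs' : (w 2 : ℂ) = 1 - w 0 - w 1 := by linear_combination hs
  refine Polynomial.funext fun x => ?_
  rw [Matrix.eval_charpoly, Matrix.det_fin_three, cubicP_eq hsum, cubicQ_eq hsum]
  simp [Matrix.diagonal_mul, hd]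
  rw [hs']
  -- One term for each 2-cycle of the determinant and one for the pair of 3-cycles.
  linear_combination (-(w 0 : ℂ) * w 1 * (x - (1 - w 0 - w 1))) * h01
    - (w 1 * (1 - w 0 - w 1) * (x - w 0)) * h12 - (w 0 * (1 - w 0 - w 1) * (x - w 1)) * h20
    - (w 0 * w 1 * (1 - w 0 - w 1)) * h3

lemma comp_prod_map_eq (a : Fin 3 → ℝ) :
    ((∏ k, (X - C (a k))).comp (X - C (1 / 3))).map (algebraMap ℝ ℂ) =
      ∏ k, (X - C (((a k + 1 / 3 : ℝ)) : ℂ)) := by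
  rw [prod_comp, Polynomial.map_prod]
  refine Finset.prod_congr rfl fun k _ => ?_
  simp only [sub_comp, X_comp, C_comp, Polynomial.map_sub, map_X, map_C, Complex.coe_algebraMap,
    Complex.ofReal_add, C_add]
  ring

/-- The Hermitian matrix of overlaps `⟨0|1⟩ = z exp(iϑ)` and `⟨1|2⟩ = ⟨2|0⟩ = z`, unit diagonal. -/
noncomputable def modelGram (ϑ z : ℝ) : Matrix (Fin 3) (Fin 3) ℂ :=
  !![1, z * Complex.exp (ϑ * Complex.I), z;
    z * Complex.exp (-ϑ * Complex.I), 1, z;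
    z, z, 1]

/-- A Hermitian matrix, affine in `z`, isospectral to `diag(w)` times `modelGram ϑ z`. -/
noncomputable def modelState (w : Fin 3 → ℝ) (ϑ z : ℝ) : Matrix (Fin 3) (Fin 3) ℂ :=
  Matrix.diagonal (fun i => ((√(w i) : ℝ) : ℂ)) * modelGram ϑ z *
    Matrix.diagonal (fun i => ((√(w i) : ℝ) : ℂ))

lemma modelGram_isHermitian (ϑ z : ℝ) : (modelGram ϑ z).IsHermitian := by
  ext i j
  fin_cases i <;> fin_cases j <;>
    simp [modelGram, ← Complex.exp_conj]

lemma modelState_isHermitian (w : Fin 3 → ℝ) (ϑ z : ℝ) : (modelState w ϑ z).IsHermitian := by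
  have hD : (Matrix.diagonal (fun i => ((√(w i) : ℝ) : ℂ)))ᴴ =
      Matrix.diagonal (fun i => ((√(w i) : ℝ) : ℂ)) := by
    rw [Matrix.diagonal_conjTranspose]
    congr 1
    ext i
    simp
  have := Matrix.isHermitian_mul_mul_conjTranspose
    (Matrix.diagonal (fun i => ((√(w i) : ℝ) : ℂ))) (modelGram_isHermitian ϑ z)
  rwa [hD] at this

/-- Affine rather than linear: the unit diagonal of `modelGram` is constant in `z`. -/
lemma modelState_affine (w : Fin 3 → ℝ) (ϑ : ℝ) (x y : ℝ) {a b : ℝ} (hab : a + b = 1) :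
    modelState w ϑ (a * x + b * y) = a • modelState w ϑ x + b • modelState w ϑ y := by
  have hG : modelGram ϑ (a * x + b * y) = a • modelGram ϑ x + b • modelGram ϑ y := by
    have hab' : (a : ℂ) + b = 1 := by exact_mod_cast hab
    ext i j
    fin_cases i <;> fin_cases j <;> simp [modelGram, hab'] <;> ring
  simp only [modelState, hG, Matrix.mul_add, Matrix.add_mul, Matrix.mul_smul, Matrix.smul_mul]

lemma modelState_charpoly {w : Fin 3 → ℝ} (hw : ∀ i, 0 ≤ w i) (hsum : ∑ i, w i = 1) (ϑ z : ℝ) :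
    (modelState w ϑ z).charpoly =
      ((X ^ 3 + C (cubicP w z) * X + C (cubicQ w ϑ z)).comp (X - C (1 / 3))).map
        (algebraMap ℝ ℂ) := by
  have hD : Matrix.diagonal (fun i => ((√(w i) : ℝ) : ℂ)) *
      Matrix.diagonal (fun i => ((√(w i) : ℝ) : ℂ)) = Matrix.diagonal (fun i => (w i : ℂ)) := by
    rw [Matrix.diagonal_mul_diagonal]
    congr 1
    ext i
    rw [← Complex.ofReal_mul, Real.mul_self_sqrt (hw i)]
  have hexp : Complex.exp (ϑ * Complex.I) * Complex.exp (-ϑ * Complex.I) = 1 := by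
    rw [← Complex.exp_add]; simp
  rw [modelState, Matrix.charpoly_mul_comm, ← Matrix.mul_assoc, hD]
  refine charpoly_diagonal_mul_eq_comp hsum ?_ ?_ ?_ ?_ ?_
  · intro i
    fin_cases i <;> simp [modelGram]
  · simp [modelGram] at hexp ⊢
    linear_combination (z : ℂ) ^ 2 * hexp
  · simp [modelGram]
    ring
  · simp [modelGram]
    ring
  · simp [modelGram, Complex.cos]
    ring

/-- Hermitian matrices have real eigenvalues. The model need not be positive semidefinite, so every
real `z` is allowed, whether or not vectors with these overlaps exist. -/
lemma four_mul_cubicP_cube_add_nonpos {w : Fin 3 → ℝ} (hw : ∀ i, 0 ≤ w i) (hsum : ∑ i, w i = 1)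
    (ϑ z : ℝ) :
    4 * cubicP w z ^ 3 + 27 * cubicQ w ϑ z ^ 2 ≤ 0 := by
  have hH := modelState_isHermitian w ϑ z
  refine four_mul_cube_add_nonpos_of_eq_prod (a := fun k => hH.eigenvalues k - 1 / 3) ?_
  have h := (modelState_charpoly hw hsum ϑ z).symm.trans hH.charpoly_eq
  have h' := comp_prod_map_eq (fun k => hH.eigenvalues k - 1 / 3)
  simp only [sub_add_cancel] at h'
  have h2 := Polynomial.map_injective _ (algebraMap ℝ ℂ).injective (h.trans h'.symm)
  -- Undo the shift by `1/3`.
  have h3 := congrArg (fun f => f.comp (X + C (1 / 3))) h2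
  simpa [comp_assoc] using h3

lemma cubic_eq_prod_t {w : Fin 3 → ℝ} (hw : ∀ i, 0 ≤ w i) (hsum : ∑ i, w i = 1) (ϑ : ℝ) {z : ℝ}
    (hz : 0 < z) :
    X ^ 3 + C (cubicP w z) * X + C (cubicQ w ϑ z) = ∏ k, (X - C (t w ϑ k z)) :=
  cubic_eq_prod_trigRoot (cubicP_neg hw hsum hz)
    (abs_core_le_one (cubicP_neg hw hsum hz) (four_mul_cubicP_cube_add_nonpos hw hsum ϑ z))

lemma modelState_charpoly_eq_prod {w : Fin 3 → ℝ} (hw : ∀ i, 0 ≤ w i) (hsum : ∑ i, w i = 1)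
    (ϑ : ℝ) {z : ℝ} (hz : 0 < z) :
    (modelState w ϑ z).charpoly = ∏ k, (X - C (((t w ϑ k z + 1 / 3 : ℝ)) : ℂ)) := by
  rw [modelState_charpoly hw hsum, cubic_eq_prod_t hw hsum ϑ hz, comp_prod_map_eq]

lemma mixture_charpoly {w : Fin 3 → ℝ} (hsum : ∑ i, w i = 1) {ϑ z : ℝ}
    {ψ : Fin 3 → EuclideanSpace ℂ (Fin 3)} (hψ : HasOverlaps ψ z ϑ) :
    (mixture w ψ).charpoly =
      ((X ^ 3 + C (cubicP w z) * X + C (cubicQ w ϑ z)).comp (X - C (1 / 3))).map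
        (algebraMap ℝ ℂ) := by
  obtain ⟨hn, τ₀₁, τ₁₂, τ₂₀, h01, h12, h20, hτ⟩ := hψ
  set Ψ : Matrix (Fin 3) (Fin 3) ℂ := Matrix.of fun i k => ψ k i with hΨ
  have hmix : mixture w ψ = Ψ * (Matrix.diagonal (fun i => (w i : ℂ)) * Ψᴴ) := by
    ext i j
    rw [mixture, Matrix.sum_apply, Matrix.mul_apply]
    refine Finset.sum_congr rfl fun k _ => ?_
    simp [hΨ, Matrix.vecMulVec_apply, Matrix.diagonal_mul]
    ring
  have hG (i j) : (Ψᴴ * Ψ) i j = inner ℂ (ψ i) (ψ j) := by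
    simp [hΨ, Matrix.mul_apply, PiLp.inner_apply, mul_comm]
  have hc (τ : ℝ) : (starRingEnd ℂ) (z * Complex.exp (τ * Complex.I)) =
      z * Complex.exp (-(τ * Complex.I)) := by
    simp [← Complex.exp_conj]
  have h10 : inner ℂ (ψ 1) (ψ 0) = (z : ℂ) * Complex.exp (-(τ₀₁ * Complex.I)) := by
    rw [← inner_conj_symm, h01, hc]
  have h21 : inner ℂ (ψ 2) (ψ 1) = (z : ℂ) * Complex.exp (-(τ₁₂ * Complex.I)) := by
    rw [← inner_conj_symm, h12, hc]
  have h02 : inner ℂ (ψ 0) (ψ 2) = (z : ℂ) * Complex.exp (-(τ₂₀ * Complex.I)) := by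
    rw [← inner_conj_symm, h20, hc]
  have hm (x : ℂ) : (z : ℂ) * Complex.exp x * (z * Complex.exp (-x)) = (z : ℂ) ^ 2 := by
    have : Complex.exp x * Complex.exp (-x) = 1 := by rw [← Complex.exp_add]; simp
    linear_combination (z : ℂ) ^ 2 * this
  rw [hmix, Matrix.charpoly_mul_comm, Matrix.mul_assoc]
  refine charpoly_diagonal_mul_eq_comp hsum ?_ ?_ ?_ ?_ ?_
  · intro i
    rw [hG, inner_self_eq_norm_sq_to_K, hn]
    simp
  · rw [hG, hG, h01, h10, hm]
  · rw [hG, hG, h12, h21, hm]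
  · rw [hG, hG, h20, h02, hm]
  · simp only [hG, h01, h12, h20, h10, h21, h02]
    have e1 : Complex.exp (ϑ * Complex.I) = Complex.exp (τ₀₁ * Complex.I) *
        Complex.exp (τ₁₂ * Complex.I) * Complex.exp (τ₂₀ * Complex.I) := by
      rw [← Complex.exp_add, ← Complex.exp_add, ← hτ]
      push_cast
      ring_nf
    have e2 : Complex.exp (-ϑ * Complex.I) = Complex.exp (-(τ₀₁ * Complex.I)) *
        Complex.exp (-(τ₁₂ * Complex.I)) * Complex.exp (-(τ₂₀ * Complex.I)) := by
      rw [← Complex.exp_add, ← Complex.exp_add, ← hτ]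
      push_cast
      ring_nf
    rw [Complex.cos, e1, e2]
    ring

end TernaryState

/-! ### Extremal eigenvalues of affine Hermitian families -/

namespace Matrix

variable {n ι : Type*} [Fintype n] [DecidableEq n] [Fintype ι] {A : Matrix n n ℂ} {l : ι → ℝ}

lemma mem_spectrum_iff_of_charpoly_eq_prod (h : A.charpoly = ∏ k, (X - C (l k : ℂ))) (x : ℂ) :
    x ∈ spectrum ℂ A ↔ ∃ k, x = l k := by
  rw [mem_spectrum_iff_isRoot_charpoly, h, IsRoot, eval_prod, Finset.prod_eq_zero_iff]
  simp [sub_eq_zero]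

/-- The spectrum of `c - A` is `{c - l k}`. This turns an eigenvalue bound into membership in the
convex cone of positive semidefinite matrices. -/
lemma posSemidef_algebraMap_sub_iff (hA : A.IsHermitian)
    (h : A.charpoly = ∏ k, (X - C (l k : ℂ))) (c : ℝ) :
    (algebraMap ℂ (Matrix n n ℂ) c - A).PosSemidef ↔ ∀ k, l k ≤ c := by
  have hH : (algebraMap ℂ (Matrix n n ℂ) c - A).IsHermitian := by
    refine IsHermitian.sub ?_ hA
    rw [algebraMap_eq_diagonal]
    exact isHermitian_diagonal_of_self_adjoint _ (by ext; simp)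
  rw [posSemidef_iff_isHermitian_and_spectrum_nonneg, ← spectrum.singleton_sub_eq]
  simp only [hH, true_and, Set.singleton_sub, Set.image_subset_iff]
  constructor
  · intro H k
    have := H ((mem_spectrum_iff_of_charpoly_eq_prod h (l k)).2 ⟨k, rfl⟩)
    simpa [← Complex.ofReal_sub] using this
  · intro H x hx
    obtain ⟨k, rfl⟩ := (mem_spectrum_iff_of_charpoly_eq_prod h x).1 hx
    simpa [← Complex.ofReal_sub] using H k

lemma posSemidef_sub_algebraMap_iff (hA : A.IsHermitian)
    (h : A.charpoly = ∏ k, (X - C (l k : ℂ))) (c : ℝ) :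
    (A - algebraMap ℂ (Matrix n n ℂ) c).PosSemidef ↔ ∀ k, c ≤ l k := by
  have hH : (A - algebraMap ℂ (Matrix n n ℂ) c).IsHermitian := by
    refine IsHermitian.sub hA ?_
    rw [algebraMap_eq_diagonal]
    exact isHermitian_diagonal_of_self_adjoint _ (by ext; simp)
  rw [posSemidef_iff_isHermitian_and_spectrum_nonneg, ← spectrum.sub_singleton_eq]
  simp only [hH, true_and, Set.sub_singleton, Set.image_subset_iff]
  constructor
  · intro H k
    have := H ((mem_spectrum_iff_of_charpoly_eq_prod h (l k)).2 ⟨k, rfl⟩)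
    simpa [← Complex.ofReal_sub] using this
  · intro H x hx
    obtain ⟨k, rfl⟩ := (mem_spectrum_iff_of_charpoly_eq_prod h x).1 hx
    simpa [← Complex.ofReal_sub] using H k

variable {s : Set ℝ} {H : ℝ → Matrix n n ℂ} {l : ι → ℝ → ℝ}

/-- The largest eigenvalue of an affine family of Hermitian matrices is convex. -/
lemma convexOn_of_charpoly_eq_prod (hs : Convex ℝ s) (hH : ∀ z, (H z).IsHermitian)
    (haff : ∀ x y a b : ℝ, a + b = 1 → H (a * x + b * y) = a • H x + b • H y)
    (hl : ∀ z ∈ s, (H z).charpoly = ∏ k, (X - C (l k z : ℂ))) {i : ι}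
    (hi : ∀ z ∈ s, ∀ k, l k z ≤ l i z) : ConvexOn ℝ s (l i) := by
  refine ⟨hs, fun x hx y hy a b ha hb hab => ?_⟩
  have hxy := hs hx hy ha hb hab
  have px := (posSemidef_algebraMap_sub_iff (hH x) (hl x hx) _).2 (hi x hx)
  have py := (posSemidef_algebraMap_sub_iff (hH y) (hl y hy) _).2 (hi y hy)
  -- The bound is `c = a * l i x + b * l i y`; then `c - H (a * x + b * y)` is the same combination
  -- of the matrices in `px` and `py`.
  refine (posSemidef_algebraMap_sub_iff (hH _) (hl _ hxy) _).1 ?_ i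
  have := (px.smul ha).add (py.smul hb)
  convert this using 1
  simp only [smul_eq_mul, haff x y a b hab, Algebra.algebraMap_eq_smul_one]
  ext i j
  simp
  ring

/-- The smallest eigenvalue of an affine family of Hermitian matrices is concave. -/
lemma concaveOn_of_charpoly_eq_prod (hs : Convex ℝ s) (hH : ∀ z, (H z).IsHermitian)
    (haff : ∀ x y a b : ℝ, a + b = 1 → H (a * x + b * y) = a • H x + b • H y)
    (hl : ∀ z ∈ s, (H z).charpoly = ∏ k, (X - C (l k z : ℂ))) {i : ι}
    (hi : ∀ z ∈ s, ∀ k, l i z ≤ l k z) : ConcaveOn ℝ s (l i) := by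
  refine ⟨hs, fun x hx y hy a b ha hb hab => ?_⟩
  have hxy := hs hx hy ha hb hab
  have px := (posSemidef_sub_algebraMap_iff (hH x) (hl x hx) _).2 (hi x hx)
  have py := (posSemidef_sub_algebraMap_iff (hH y) (hl y hy) _).2 (hi y hy)
  refine (posSemidef_sub_algebraMap_iff (hH _) (hl _ hxy) _).1 ?_ i
  have := (px.smul ha).add (py.smul hb)
  convert this using 1
  simp only [smul_eq_mul, haff x y a b hab, Algebra.algebraMap_eq_smul_one]
  ext i j
  simp
  ring

end Matrix

end

theorem mainTheorem3 (w : Fin 3 → ℝ) (hw : ∀ i, 0 ≤ w i) (hsum : ∑ i, w i = 1) (ϑ : ℝ) :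
    -- `t₀ + 1/3, t₁ + 1/3, t₂ + 1/3` are the eigenvalues of `ϖ`, with multiplicity
    (∀ z ∈ Set.Ioo (0 : ℝ) 1, ∀ ψ : Fin 3 → EuclideanSpace ℂ (Fin 3),
      TernaryState.HasOverlaps ψ z ϑ →
        (TernaryState.mixture w ψ).charpoly =
          ∏ k, (Polynomial.X -
            Polynomial.C (((TernaryState.t w ϑ k z + 1 / 3 : ℝ)) : ℂ))) ∧
    -- the formula for `t_k` is well defined, and `t₀ ≥ t₁ ≥ t₂` are the roots of the
    -- reduced cubic, with multiplicity
    (∀ z ∈ Set.Ioo (0 : ℝ) 1,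
      TernaryState.cubicP w z < 0 ∧
      |TernaryState.core (TernaryState.cubicP w z) (TernaryState.cubicQ w ϑ z)| ≤ 1 ∧
      (Polynomial.X ^ 3 + Polynomial.C (TernaryState.cubicP w z) * Polynomial.X
          + Polynomial.C (TernaryState.cubicQ w ϑ z) =
        ∏ k, (Polynomial.X - Polynomial.C (TernaryState.t w ϑ k z))) ∧
      TernaryState.t w ϑ 1 z ≤ TernaryState.t w ϑ 0 z ∧
      TernaryState.t w ϑ 2 z ≤ TernaryState.t w ϑ 1 z) ∧
    -- the symmetry `t₂(p, q) = -t₀(p, -q)`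
    (∀ p q : ℝ, TernaryState.trigRoot 2 p q = -TernaryState.trigRoot 0 p (-q)) ∧
    -- `t₀` is convex and `t₂` is concave on `(0, 1)`
    ConvexOn ℝ (Set.Ioo (0 : ℝ) 1) (TernaryState.t w ϑ 0) ∧
    ConcaveOn ℝ (Set.Ioo (0 : ℝ) 1) (TernaryState.t w ϑ 2) := by
  have hle (z : ℝ) := TernaryState.trigRoot_one_le_trigRoot_zero
    (TernaryState.cubicP w z) (TernaryState.cubicQ w ϑ z)
  have hle' (z : ℝ) := TernaryState.trigRoot_two_le_trigRoot_one
    (TernaryState.cubicP w z) (TernaryState.cubicQ w ϑ z)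
  have hl (z : ℝ) (hz : z ∈ Set.Ioo (0 : ℝ) 1) :=
    TernaryState.modelState_charpoly_eq_prod hw hsum ϑ hz.1
  refine ⟨fun z hz ψ hψ => ?_, fun z hz => ⟨TernaryState.cubicP_neg hw hsum hz.1,
    TernaryState.abs_core_le_one (TernaryState.cubicP_neg hw hsum hz.1)
      (TernaryState.four_mul_cubicP_cube_add_nonpos hw hsum ϑ z),
    TernaryState.cubic_eq_prod_t hw hsum ϑ hz.1, hle z, hle' z⟩,
    TernaryState.trigRoot_two, ?_, ?_⟩
  · rw [TernaryState.mixture_charpoly hsum hψ, TernaryState.cubic_eq_prod_t hw hsum ϑ hz.1,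
      TernaryState.comp_prod_map_eq]
  · have := Matrix.convexOn_of_charpoly_eq_prod (l := fun k z => TernaryState.t w ϑ k z + 1 / 3)
      (i := 0) (convex_Ioo 0 1) (TernaryState.modelState_isHermitian w ϑ)
      (fun x y a b => TernaryState.modelState_affine w ϑ x y) hl (fun z _ k => by
        simp only [TernaryState.t]
        fin_cases k <;> simp <;> linarith [hle z, hle' z])
    exact (this.add_const (-(1 / 3))).congr fun z _ => by simp
  · have := Matrix.concaveOn_of_charpoly_eq_prod (l := fun k z => TernaryState.t w ϑ k z + 1 / 3)
      (i := 2) (convex_Ioo 0 1) (TernaryState.modelState_isHermitian w ϑ)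
      (fun x y a b => TernaryState.modelState_affine w ϑ x y) hl (fun z _ k => by
        simp only [TernaryState.t]
        fin_cases k <;> simp <;> linarith [hle z, hle' z])
    exact (this.add_const (-(1 / 3))).congr fun z _ => by simp
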